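/- The triangular lattice is the infinite graph whose vertices are the points $x\,(1,0)+y\,(\tfrac12,\tfrac{\sqrt3}{2})$ with $x,y\in\mathbb{Z}$, two of them being adjacent exactly when they are at Euclidean distance $1$. A hexagonal graph is a finite triangle-free graph that is (isomorphic to) an induced subgraph of the triangular lattice. For integers $a,b$, a graph is $(a,b)$-colorable if one can assign to each vertex a set of exactly $b$ colors from a fixed set of $a$ colors so that adjacent vertices receive disjoint sets. Every hexagonal graph is $(3,1)$-colorable, $(5,2)$-colorable and $(7,3)$-colorable. -/

import Mathlib

/-- `c` is an `(a, b)`-coloring of `G`: each vertex receives a set of exactly `b` colors among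
`a` colors, and adjacent vertices receive disjoint sets. -/
def IsMulticoloring {V : Type*} (G : SimpleGraph V) (a b : ℕ) (c : V → Finset (Fin a)) : Prop :=
  (∀ v, (c v).card = b) ∧ ∀ v w, G.Adj v w → Disjoint (c v) (c w)

/-- `G` is `(a, b)`-colorable. -/
def IsMulticolorable {V : Type*} (G : SimpleGraph V) (a b : ℕ) : Prop :=
  ∃ c : V → Finset (Fin a), IsMulticoloring G a b c

/-- The triangular lattice. The pair `(x, y)` stands for the point `x • (1, 0) + y • (1/2, √3/2)`
of the Euclidean plane; each point is adjacent to the six points at distance one from it. -/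
def triangularLattice : SimpleGraph (ℤ × ℤ) where
  Adj p q := q - p ∈ ({(1, 0), (0, 1), (-1, 1), (-1, 0), (0, -1), (1, -1)} : Set (ℤ × ℤ))
  symm := ⟨by
    rintro ⟨a, b⟩ ⟨c, d⟩ h
    simp only [Prod.mk_sub_mk, Set.mem_insert_iff, Set.mem_singleton_iff, Prod.mk.injEq] at h ⊢
    omega⟩
  loopless := ⟨by
    rintro ⟨a, b⟩ h
    simp [Prod.ext_iff] at h⟩

/-- A hexagonal graph is a finite triangle-free graph that is (isomorphic to) an induced subgraph
of the triangular lattice. Graph embeddings `↪g` preserve and reflect adjacency. -/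
def IsHexagonalGraph {V : Type*} (G : SimpleGraph V) : Prop :=
  Finite V ∧ G.CliqueFree 3 ∧ Nonempty (G ↪g triangularLattice)

/-! A (7,3)-coloring is a homomorphism to the Kneser graph K(7,3), and K(7,3) maps to K(5,2), which
maps to K(3,1); so one homomorphism to K(7,3) settles all three claims. It is built by induction on
the number of vertices (`exists_kneserColoring`). A vertex of degree at most one can be removed and
colored last.

Otherwise some row contains a run of k vertices with nothing above it (`exists_peakRun`).
Triangle-freeness forces k ≥ 2 and leaves the run attached to the rest only at its two feet, one
below each end. After the run is deleted and the rest colored, the run can be restored exactly when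
K(7,3) has a walk of length k + 1 between the colors of the feet (`PeakRun.exists_extension`).

Such walks are easy to describe: length 3 requires triples sharing at most one element, length 4
requires triples that meet, length 5 distinct triples, and from length 6 on nothing is required.
Hence only k = 2, 3, 4 need work. There, either a path under the run already has the right length,
or vertices near the feet have degree two in the remaining graph and leave a choice of colors for
the feet (`exists_recoloring`, `exists_flexible`), enough to meet the requirement. -/

/-- The subsets of size three of a set of size seven, as bit masks. -/
def triples : List ℕ :=
  [7, 11, 13, 14, 19, 21, 22, 25, 26, 28, 35, 37, 38, 41, 42, 44, 49, 50, 52, 56, 67, 69, 70, 73,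
    74, 76, 81, 82, 84, 88, 97, 98, 100, 104, 112]

/-- The sets with the masks `a` and `b` are disjoint. -/
def maskDisj (a b : ℕ) : Bool := Nat.beq (Nat.land a b) 0

/-- The sets with the masks `a` and `b` have at most one element in common. -/
def maskFar (a b : ℕ) : Bool := Nat.beq (Nat.land (Nat.land a b) (Nat.sub (Nat.land a b) 1)) 0

/-- The vertices of the Kneser graph `K(7, 3)`. -/
abbrev Triple := {m : ℕ // m ∈ triples}

/-! ### Disjointness, closeness and walks in K(7,3). -/

namespace Triple

/-- The two triples are disjoint. -/
def Disj (A B : Triple) : Prop := maskDisj A.1 B.1 = true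

/-- The two triples have at least two elements in common. -/
def Close (A B : Triple) : Prop := maskFar A.1 B.1 = false

theorem Disj.symm {A B : Triple} (h : A.Disj B) : B.Disj A := by
  unfold Disj maskDisj at *; rwa [show Nat.land B.1 A.1 = Nat.land A.1 B.1 from Nat.land_comm _ _]

theorem Close.symm {A B : Triple} (h : A.Close B) : B.Close A := by
  unfold Close maskFar at *
  rwa [show Nat.land B.1 A.1 = Nat.land A.1 B.1 from Nat.land_comm _ _]

theorem not_close_iff {A B : Triple} : ¬ A.Close B ↔ maskFar A.1 B.1 = true := by
  simp [Close]

theorem disj_iff {A B : Triple} : A.Disj B ↔ A.1 &&& B.1 = 0 :=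
  by
  unfold Disj maskDisj
  rw [Nat.beq_eq]
  rfl

theorem forall_of_all {p : ℕ → Bool} (h : triples.all p = true) (A : Triple) : p A.1 = true :=
  List.all_eq_true.1 h A.1 A.2

theorem exists_of_any {p : ℕ → Bool} (h : triples.any p = true) : ∃ A : Triple, p A.1 = true := by
  obtain ⟨a, ha, h⟩ := List.any_eq_true.1 h
  exact ⟨⟨a, ha⟩, h⟩

theorem close_self (A : Triple) : A.Close A := by
  have : (triples.all fun a => !maskFar a a) = true := by decide +kernel
  simpa [Close] using forall_of_all this A

theorem exists_disj (A : Triple) : ∃ B : Triple, B.Disj A := by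
  have : (triples.all fun a => triples.any fun b => maskDisj b a) = true := by decide +kernel
  exact exists_of_any (forall_of_all this A)

/-- The union of the two triples has at most four elements, so three remain for `C`. -/
theorem Close.exists_disj {A B : Triple} (h : A.Close B) : ∃ C : Triple, A.Disj C ∧ C.Disj B := by
  have : (triples.all fun a => triples.all fun b => maskFar a b ||
      triples.any fun c => maskDisj a c && maskDisj c b) = true := by decide +kernel
  have := forall_of_all (forall_of_all this A) B
  rw [show maskFar A.1 B.1 = false from h, Bool.false_or] at this
  obtain ⟨C, hC⟩ := exists_of_any this
  rw [Bool.and_eq_true] at hC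
  exact ⟨C, hC.1, hC.2⟩

/-- Both triples lie in the four-element complement of `B`. -/
theorem Disj.close {A B C : Triple} (h : A.Disj B) (h' : B.Disj C) : A.Close C := by
  have : (triples.all fun a => triples.all fun b => !maskDisj a b ||
      triples.all fun c => !maskDisj b c || !maskFar a c) = true := by decide +kernel
  have := forall_of_all (forall_of_all this A) B
  rw [show maskDisj A.1 B.1 = true from h, Bool.not_true, Bool.false_or] at this
  have := forall_of_all this C
  rw [show maskDisj B.1 C.1 = true from h', Bool.not_true, Bool.false_or] at this
  simpa [Close] using this

/-- Otherwise the three elements of `T` would include two from each of two disjoint sets.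
Equivalently, K(7,3) has no closed walk of length 5. -/
theorem Disj.not_close {A Y T : Triple} (h : A.Disj Y) (h' : A.Close T) : ¬ Y.Close T := by
  have : (triples.all fun a => triples.all fun y => !maskDisj a y ||
      triples.all fun t => maskFar a t || maskFar y t) = true := by decide +kernel
  have := forall_of_all (forall_of_all this A) Y
  rw [show maskDisj A.1 Y.1 = true from h, Bool.not_true, Bool.false_or] at this
  have := forall_of_all this T
  rw [show maskFar A.1 T.1 = false from h', Bool.false_or] at this
  simpa [Close] using this

theorem Close.not_disj {A B C : Triple} (h : A.Close B) (h' : A.Close C) : ¬ B.Disj C :=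
  fun h3 => h3.not_close h.symm h'.symm

/-- At least two elements of `T` lie in the four-element complement of `Y`. Fix two of them; each of
the other two elements of the complement completes them to a suitable triple, and the two triples
cover the complement. -/
theorem exists_pair {Y T : Triple} (h : ¬ Y.Close T) : ∃ A A' : Triple, A ≠ A' ∧ A.Disj Y ∧
    A'.Disj Y ∧ A.Close T ∧ A'.Close T ∧ A.1 ||| A'.1 = 127 - Y.1 := by
  have : (triples.all fun y => triples.all fun t => !maskFar y t ||
      triples.any fun a => (maskDisj a y && !maskFar a t) &&
        triples.any fun b => (maskDisj b y && !maskFar b t) &&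
          (!Nat.beq a b && Nat.beq (Nat.lor a b) (127 - y))) = true := by decide +kernel
  have := forall_of_all (forall_of_all this Y) T
  rw [not_close_iff.1 h, Bool.not_true, Bool.false_or] at this
  obtain ⟨A, hA⟩ := exists_of_any this
  obtain ⟨hA, hB⟩ := Bool.and_eq_true_iff.1 hA
  obtain ⟨B, hB⟩ := exists_of_any hB
  simp only [Bool.and_eq_true, Bool.not_eq_true', Nat.beq_eq] at hA hB
  refine ⟨A, B, ?_, hA.1, hB.1.1, hA.2, hB.1.2, hB.2.2⟩
  rintro rfl
  simp at hB

/-- A triple disjoint from `Y` and close to `T` can be chosen distinct from a given one. -/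
theorem exists_ne {Y T : Triple} (h : ¬ Y.Close T) (R : Triple) :
    ∃ A : Triple, A.Disj Y ∧ A.Close T ∧ A ≠ R := by
  obtain ⟨A, A', hne, h1, h2, h3, h4, -⟩ := exists_pair h
  by_cases hA : A = R
  · exact ⟨A', h2, h4, fun h => hne (hA.trans h.symm)⟩
  · exact ⟨A, h1, h3, hA⟩

theorem not_disj_of_or {A A' Z : Triple} {m : ℕ} (h : A.1 ||| A'.1 = m) (hm : m &&& Z.1 ≠ 0) :
    ¬ A.Disj Z ∨ ¬ A'.Disj Z := by
  by_contra! hc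
  apply hm
  rw [← h, Nat.and_or_distrib_right, disj_iff.1 hc.1, disj_iff.1 hc.2]
  rfl

/-- If `Z` missed both triples of `exists_pair`, it would miss the complement of `Y` and so equal
`Y`. -/
theorem exists_not_disj_of_ne {Y T Z : Triple} (h : ¬ Y.Close T) (hZ : Z ≠ Y) :
    ∃ A : Triple, A.Disj Y ∧ A.Close T ∧ ¬ A.Disj Z := by
  obtain ⟨A, A', -, h1, h2, h3, h4, h5⟩ := exists_pair h
  have key : (triples.all fun y => triples.all fun z =>
    Nat.beq z y || !maskDisj (127 - y) z) = true := by decide +kernel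
  have key := forall_of_all (forall_of_all key Y) Z
  have hZ' : Z.1 ≠ Y.1 := fun e => hZ (Subtype.ext e)
  simp only [maskDisj, Bool.or_eq_true, Nat.beq_eq, hZ', false_or, Bool.not_eq_true',
    Bool.eq_false_iff, ne_eq] at key
  rcases not_disj_of_or (Z := Z) h5 key with h | h
  · exact ⟨A, h1, h3, h⟩
  · exact ⟨A', h2, h4, h⟩

/-- The candidates for `A` cover the complement of `Y`, those for `B` the complement of `Y'`; two
four-element subsets of a seven-element set meet. -/
theorem exists_not_disj {Y T Y' T' : Triple} (h : ¬ Y.Close T) (h' : ¬ Y'.Close T') :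
    ∃ A B : Triple, A.Disj Y ∧ A.Close T ∧ B.Disj Y' ∧ B.Close T' ∧ ¬ A.Disj B := by
  obtain ⟨A, A', -, h1, h2, h3, h4, h5⟩ := exists_pair h
  by_cases hc : ∃ B : Triple, B.Disj Y' ∧ B.Close T' ∧ (127 - Y.1) &&& B.1 ≠ 0
  · obtain ⟨B, hB1, hB2, hB3⟩ := hc
    rcases not_disj_of_or h5 hB3 with h | h
    · exact ⟨A, B, h1, h3, hB1, hB2, h⟩
    · exact ⟨A', B, h2, h4, hB1, hB2, h⟩
  · exfalso
    obtain ⟨B, B', -, g1, g2, g3, g4, g5⟩ := exists_pair h'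
    push Not at hc
    have key : (triples.all fun y => triples.all fun z =>
      !maskDisj (127 - y) (127 - z)) = true := by decide +kernel
    have key := forall_of_all (forall_of_all key Y) Y'
    simp only [maskDisj, Bool.not_eq_true', Bool.eq_false_iff, Nat.beq_eq, ne_eq] at key
    apply key
    change (127 - Y.1) &&& (127 - Y'.1) = 0
    rw [← g5, Nat.and_or_distrib_left, hc B g1 g3, hc B' g2 g4]
    rfl

theorem exists_disj_not_disj {Z R : Triple} (h : Z ≠ R) :
    ∃ A : Triple, A.Disj Z ∧ ¬ A.Disj R := by
  obtain ⟨T, hT⟩ := exists_disj Z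
  obtain ⟨A, h1, -, h2⟩ := exists_not_disj_of_ne (hT.not_close (close_self T)) h.symm
  exact ⟨A, h1, h2⟩

theorem exists_disj_not_close {Z B : Triple} (h : ¬ B.Disj Z) :
    ∃ A : Triple, A.Disj Z ∧ ¬ A.Close B := by
  have : (triples.all fun z => triples.all fun b => maskDisj b z ||
      triples.any fun a => maskDisj a z && maskFar a b) = true := by decide +kernel
  have := forall_of_all (forall_of_all this Z) B
  rw [Bool.eq_false_iff.2 h, Bool.false_or] at this
  obtain ⟨C, hC⟩ := exists_of_any this
  rw [Bool.and_eq_true] at hC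
  exact ⟨C, hC.1, not_close_iff.2 hC.2⟩

theorem exists_close_not_close {T B : Triple} (h : B ≠ T) :
    ∃ A : Triple, A.Close T ∧ ¬ A.Close B := by
  obtain ⟨A, h1, h2⟩ := exists_disj_not_disj h.symm
  obtain ⟨C, h3, h4⟩ := exists_disj_not_close fun e : B.Disj A => h2 e.symm
  exact ⟨C, h3.close h1, h4⟩

/-- There are two candidates that are not close to each other, and no `Z` is disjoint from both of
them. -/
theorem exists_close_close_not_disj {T T' : Triple} (h : ¬ T.Disj T') (Z : Triple) :
    ∃ A : Triple, A.Close T ∧ A.Close T' ∧ ¬ A.Disj Z := by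
  have : (triples.all fun t => triples.all fun t' => maskDisj t t' ||
      triples.any fun a => (!maskFar a t && !maskFar a t') &&
        triples.any fun b => maskFar a b && (!maskFar b t && !maskFar b t')) = true := by
    decide +kernel
  have := forall_of_all (forall_of_all this T) T'
  rw [Bool.eq_false_iff.2 h, Bool.false_or] at this
  obtain ⟨A, hA⟩ := exists_of_any this
  obtain ⟨hA, hB⟩ := Bool.and_eq_true_iff.1 hA
  obtain ⟨B, hB⟩ := exists_of_any hB
  simp only [Bool.and_eq_true, Bool.not_eq_true'] at hA hB
  by_cases hZ : A.Disj Z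
  · exact ⟨B, hB.2.1, hB.2.2, fun hZ' => not_close_iff.2 hB.1 (hZ.close hZ'.symm)⟩
  · exact ⟨A, hA.1, hA.2, hZ⟩

theorem exists_close_not_disj (T R : Triple) : ∃ A : Triple, A.Close T ∧ ¬ A.Disj R := by
  obtain ⟨A, h1, -, h2⟩ :=
    exists_close_close_not_disj ((close_self T).not_disj (close_self T)) R
  exact ⟨A, h1, h2⟩

/-- `Walk n A B`: there is a walk of length `n` from `A` to `B` in the Kneser graph. -/
def Walk (n : ℕ) (A B : Triple) : Prop :=
  ∃ g : ℕ → Triple, g 0 = A ∧ g n = B ∧ ∀ i < n, (g i).Disj (g (i + 1))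

theorem Walk.nil (A : Triple) : Walk 0 A A := ⟨fun _ => A, rfl, rfl, by simp⟩

theorem Walk.cons {n : ℕ} {A B C : Triple} (h : A.Disj B) (h' : Walk n B C) :
    Walk (n + 1) A C := by
  obtain ⟨g, h0, hn, hg⟩ := h'
  refine ⟨fun i => if i = 0 then A else g (i - 1), by simp, by simp [hn], ?_⟩
  rintro (_ | i) hi
  · simpa [h0] using h
  · simpa using hg i (by omega)

theorem Close.walk {A B : Triple} (h : A.Close B) : Walk 2 A B := by
  obtain ⟨C, h1, h2⟩ := h.exists_disj
  exact .cons h1 (.cons h2 (.nil B))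

theorem walk_three {A B : Triple} (h : ¬ A.Close B) : Walk 3 A B := by
  obtain ⟨C, h1, h2, -⟩ := exists_ne h A
  exact .cons h1.symm h2.walk

theorem walk_four {A B : Triple} (h : ¬ A.Disj B) : Walk 4 A B := by
  obtain ⟨C, h1, h2⟩ := exists_disj_not_close fun e => h e.symm
  exact .cons h1.symm (walk_three h2)

theorem walk_five {A B : Triple} (h : A ≠ B) : Walk 5 A B := by
  obtain ⟨C, h1, h2⟩ := exists_disj_not_disj h
  exact .cons h1.symm (walk_four h2)

theorem walk_of_six_le {n : ℕ} (hn : 6 ≤ n) (A B : Triple) : Walk n A B := by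
  induction n, hn using Nat.le_induction generalizing A with
  | base =>
    obtain ⟨T, hT⟩ := exists_disj A
    obtain ⟨C, h1, -, h2⟩ := exists_ne (hT.not_close (close_self T)) B
    exact .cons h1.symm (walk_five h2)
  | succ n _ ih =>
    obtain ⟨C, h⟩ := exists_disj A
    exact .cons h.symm (ih C)

end Triple

/-! ### Recoloring a vertex together with its neighbors. -/

/-- `c` is a homomorphism to the Kneser graph `K(7, 3)` on the vertices in `S`. -/
def KneserColoring {α : Type*} (G : SimpleGraph α) (S : Set α) (c : α → Triple) : Prop :=
  ∀ v ∈ S, ∀ w ∈ S, G.Adj v w → (c v).Disj (c w)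

/-- No three vertices in `S` are pairwise adjacent. -/
def TriangleFreeOn {α : Type*} (G : SimpleGraph α) (S : Set α) : Prop :=
  ∀ u ∈ S, ∀ v ∈ S, ∀ w ∈ S, G.Adj u v → G.Adj v w → ¬ G.Adj u w

section Recoloring

variable {α : Type*} {G : SimpleGraph α} {S : Set α} {c : α → Triple}

theorem TriangleFreeOn.mono {S' : Set α} (h : TriangleFreeOn G S) (hS : S' ⊆ S) :
    TriangleFreeOn G S' :=
  fun u hu v hv w hw => h u (hS hu) v (hS hv) w (hS hw)

theorem KneserColoring.mono {S' : Set α} (h : KneserColoring G S c) (hS : S' ⊆ S) :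
    KneserColoring G S' c :=
  fun u hu v hv => h u (hS hu) v (hS hv)

/-- The vertex `v` can receive the color `A` if each neighbor either has a color disjoint from `A`
or has only one other neighbor, whose color is close to `A`. -/
theorem exists_recoloring (hS : TriangleFreeOn G S) {v : α} (hv : v ∈ S)
    (hc : KneserColoring G (S \ {v}) c) {A : Triple}
    (h : ∀ w ∈ S, G.Adj v w → A.Disj (c w) ∨
      ∃ w' ∈ S, (∀ u ∈ S, G.Adj w u → u = v ∨ u = w') ∧ A.Close (c w')) :
    ∃ c', KneserColoring G S c' ∧ c' v = A ∧ ∀ u, u ≠ v → ¬ G.Adj v u → c' u = c u := by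
  classical
  have key : ∀ w, ∃ B : Triple, w ∈ S → G.Adj v w → A.Disj B ∧
      ∀ u ∈ S, G.Adj w u → u ≠ v → B.Disj (c u) := by
    intro w
    by_cases hw : w ∈ S ∧ G.Adj v w
    · rcases h w hw.1 hw.2 with h | ⟨w', hw', hu, hA⟩
      · refine ⟨c w, fun _ _ => ⟨h, fun u hu hwu huv => ?_⟩⟩
        exact hc w ⟨hw.1, hw.2.ne'⟩ u ⟨hu, huv⟩ hwu
      · obtain ⟨B, hB1, hB2⟩ := hA.exists_disj
        refine ⟨B, fun _ _ => ⟨hB1, fun u huS hwu huv => ?_⟩⟩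
        rwa [(hu u huS hwu).resolve_left huv]
    · exact ⟨A, fun h1 h2 => absurd ⟨h1, h2⟩ hw⟩
  choose B hB using key
  refine ⟨fun u => if u = v then A else if G.Adj v u then B u else c u, ?_, by simp, ?_⟩
  · have main : ∀ x ∈ S, ∀ y ∈ S, G.Adj x y → y ≠ v → ¬ G.Adj v y →
        Triple.Disj (if x = v then A else if G.Adj v x then B x else c x) (c y) := by
      intro x hx y hy hxy hyv hvy
      have hxv : x ≠ v := by rintro rfl; exact hvy hxy
      rw [if_neg hxv]
      split_ifs with hvx
      · exact (hB x hx hvx).2 y hy hxy hyv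
      · exact hc x ⟨hx, hxv⟩ y ⟨hy, hyv⟩ hxy
    intro x hx y hy hxy
    by_cases hyv : y = v
    · subst hyv
      simp only [if_true, hxy.ne, if_false, hxy.symm]
      exact (hB x hx hxy.symm).1.symm
    by_cases hvy : G.Adj v y
    · by_cases hxv : x = v
      · subst hxv
        simp only [if_true, hyv, if_false, hxy]
        exact (hB y hy hxy).1
      -- Two neighbors of `v` are never adjacent, so their new colors cannot conflict.
      · have hvx : ¬ G.Adj v x := fun hvx => hS v hv x hx y hy hvx hxy hvy
        have := main y hy x hx hxy.symm hxv hvx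
        simp only [hxv, hvx, if_false] at this ⊢
        exact this.symm
    · have := main x hx y hy hxy hyv hvy
      simpa only [hyv, hvy, if_false] using this
  · intro u hu hvu
    simp [hu, hvu]

/-- In every coloring that agrees with `c` on `X`, the vertex `v` can receive each color that is
disjoint from `Y` and close to `T`. -/
def Flexible (G : SimpleGraph α) (S : Set α) (c : α → Triple) (v : α) (X : Set α)
    (Y T : Triple) : Prop :=
  ∀ c₁, KneserColoring G (S \ {v}) c₁ → (∀ u ∈ X, c₁ u = c u) → ∀ A : Triple, A.Disj Y →
    A.Close T → ∃ c₂, KneserColoring G S c₂ ∧ c₂ v = A ∧ ∀ u, u ≠ v → ¬ G.Adj v u → c₂ u = c₁ u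

/-- `Y` is the color of `n₁`, which stays fixed, and `T` the color of `w'`, the only constraint on
`n₂` besides `v`. If one of these neighbors is absent, its triple is chosen freely. The old color of
`v` is disjoint from `Y` and close to `T`, which shows that `Y` and `T` are not close. -/
theorem exists_flexible (hS : TriangleFreeOn G S) {v : α} (hv : v ∈ S)
    (hc : KneserColoring G S c) (n₁ n₂ w' : α) (hn : ∀ u ∈ S, G.Adj v u → u = n₁ ∨ u = n₂)
    (h : n₂ ∈ S → G.Adj v n₂ → w' ∈ S ∧ G.Adj n₂ w' ∧ ∀ u ∈ S, G.Adj n₂ u → u = v ∨ u = w') :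
    ∃ Y T, ¬ Triple.Close Y T ∧ Flexible G S c v {n₁, w'} Y T := by
  classical
  obtain ⟨Y, hY1, hY2⟩ : ∃ Y : Triple, (c v).Disj Y ∧ (n₁ ∈ S → G.Adj v n₁ → Y = c n₁) := by
    by_cases h1 : n₁ ∈ S ∧ G.Adj v n₁
    · exact ⟨c n₁, hc v hv n₁ h1.1 h1.2, fun _ _ => rfl⟩
    · obtain ⟨Y, hY⟩ := (c v).exists_disj
      exact ⟨Y, hY.symm, fun h2 h3 => absurd ⟨h2, h3⟩ h1⟩
  obtain ⟨T, hT1, hT2⟩ : ∃ T : Triple, (c v).Close T ∧ (n₂ ∈ S → G.Adj v n₂ → T = c w') := by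
    by_cases h1 : n₂ ∈ S ∧ G.Adj v n₂
    · obtain ⟨h2, h3, -⟩ := h h1.1 h1.2
      exact ⟨c w', (hc v hv n₂ h1.1 h1.2).close (hc n₂ h1.1 w' h2 h3), fun _ _ => rfl⟩
    · exact ⟨c v, (c v).close_self, fun h2 h3 => absurd ⟨h2, h3⟩ h1⟩
  refine ⟨Y, T, hY1.not_close hT1, fun c₁ hc₁ hX A hA hA' => ?_⟩
  apply exists_recoloring hS hv hc₁
  intro w hw hvw
  rcases hn w hw hvw with rfl | rfl
  · left
    rwa [hX _ (by simp), ← hY2 hw hvw]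
  · right
    obtain ⟨h2, -, h4⟩ := h hw hvw
    refine ⟨w', h2, h4, ?_⟩
    rwa [hX _ (by simp), ← hT2 hw hvw]

end Recoloring

/-! ### The neighborhood of a peak run. -/

theorem triangularLattice_adj {a b x y : ℤ} : triangularLattice.Adj (a, b) (x, y) ↔
    -1 ≤ x - a ∧ x - a ≤ 1 ∧ -1 ≤ y - b ∧ y - b ≤ 1 ∧ -1 ≤ x - a + (y - b) ∧
      x - a + (y - b) ≤ 1 ∧ ¬ (x = a ∧ y = b) := by
  simp only [triangularLattice, Prod.mk_sub_mk, Set.mem_insert_iff, Set.mem_singleton_iff,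
    Prod.mk.injEq]
  omega

theorem triangularLattice_adj_cases {a b x y : ℤ} (h : triangularLattice.Adj (a, b) (x, y)) :
    x = a + 1 ∧ y = b ∨ x = a ∧ y = b + 1 ∨ x = a - 1 ∧ y = b + 1 ∨ x = a - 1 ∧ y = b ∨
      x = a ∧ y = b - 1 ∨ x = a + 1 ∧ y = b - 1 := by
  rw [triangularLattice_adj] at h
  omega

theorem TriangleFreeOn.false {V : Set (ℤ × ℤ)} (hV : TriangleFreeOn triangularLattice V)
    {a b x y z w : ℤ} (h₁ : (a, b) ∈ V) (h₂ : (x, y) ∈ V) (h₃ : (z, w) ∈ V)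
    (h : triangularLattice.Adj (a, b) (x, y) ∧ triangularLattice.Adj (x, y) (z, w) ∧
      triangularLattice.Adj (a, b) (z, w)) : False :=
  hV _ h₁ _ h₂ _ h₃ h.1 h.2.1 h.2.2

/-- A vertex with a neighbor `v` whose other neighbors are among two adjacent ones has degree
two. -/
theorem exists_unique_other_neighbor {α : Type*} {G : SimpleGraph α} {V : Set α}
    (hV : TriangleFreeOn G V) (hdeg : ∀ v ∈ V, ∀ w₀, ∃ w ∈ V, G.Adj v w ∧ w ≠ w₀)
    {n v w₁ w₂ : α} (hn : n ∈ V) (hw : G.Adj w₁ w₂)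
    (h : ∀ u ∈ V, G.Adj n u → u = v ∨ u = w₁ ∨ u = w₂) :
    ∃ w', (w' = w₁ ∨ w' = w₂) ∧ w' ∈ V ∧ G.Adj n w' ∧ ∀ u ∈ V, G.Adj n u → u = v ∨ u = w' := by
  obtain ⟨w, hwV, hnw, hwv⟩ := hdeg n hn v
  have h' := (h w hwV hnw).resolve_left hwv
  refine ⟨w, h', hwV, hnw, fun u hu hnu => ?_⟩
  rcases h' with rfl | rfl <;> rcases h u hu hnu with h1 | rfl | rfl
  · exact .inl h1
  · exact .inr rfl
  · exact absurd hnu (hV n hn _ hwV _ hu hnw hw)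
  · exact .inl h1
  · exact absurd hnu (hV n hn _ hwV _ hu hnw hw.symm)
  · exact .inr rfl

/-- The row of height one of `V` starts with a run of `k` vertices at `(0, 1)`, and no vertex of
the run has a neighbor above it. Moreover, `V` has no triangles and no vertices of degree less
than two. -/
structure PeakRun (V : Set (ℤ × ℤ)) (k : ℤ) : Prop where
  triangleFree : TriangleFreeOn triangularLattice V
  two_le_degree : ∀ v ∈ V, ∀ w₀, ∃ w ∈ V, triangularLattice.Adj v w ∧ w ≠ w₀
  pos : 1 ≤ k
  mem : ∀ i, 0 ≤ i → i < k → (i, 1) ∈ V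
  left : ∀ i < 0, (i, 1) ∉ V
  right : (k, 1) ∉ V
  above : ∀ i < k, (i, 2) ∉ V
  -- Needed only in `exists_flexible_below`, to give (-1, -1) degree two.
  below : (-2, 0) ∈ V → (-1, 0) ∈ V

/-- `V` without the run. -/
def withoutRun (V : Set (ℤ × ℤ)) (k : ℤ) : Set (ℤ × ℤ) :=
  {v ∈ V | ¬ (v.2 = 1 ∧ 0 ≤ v.1 ∧ v.1 < k)}

namespace PeakRun

variable {V : Set (ℤ × ℤ)} {k : ℤ} {c : ℤ × ℤ → Triple}

theorem withoutRun_subset : withoutRun V k ⊆ V := fun _ h => h.1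

theorem triangleFree_withoutRun (hV : PeakRun V k) :
    TriangleFreeOn triangularLattice (withoutRun V k) :=
  hV.triangleFree.mono withoutRun_subset

theorem mem_of_eq {x y x' y' : ℤ} (h : (x, y) ∈ V) (hx : x = x') (hy : y = y') : (x', y') ∈ V := by
  subst hx hy; exact h

theorem mem_withoutRun {x y : ℤ} (h : (x, y) ∈ V) (h' : ¬ (y = 1 ∧ 0 ≤ x ∧ x < k)) :
    (x, y) ∈ withoutRun V k := ⟨h, h'⟩

/-- A single vertex could only have the neighbors (0, 0) and (1, 0), which are adjacent to each
other. -/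
theorem two_le (hV : PeakRun V k) : 2 ≤ k := by
  by_contra hk
  obtain rfl : k = 1 := by have := hV.pos; omega
  have h0 := hV.mem 0 le_rfl one_pos
  have h : ∀ x y, (x, y) ∈ V → triangularLattice.Adj (0, 1) (x, y) →
      x = 0 ∧ y = 0 ∨ x = 1 ∧ y = 0 := by
    intro x y hxy hadj
    rcases triangularLattice_adj_cases hadj with ⟨rfl, rfl⟩ | ⟨rfl, rfl⟩ | ⟨rfl, rfl⟩ |
      ⟨rfl, rfl⟩ | ⟨rfl, rfl⟩ | ⟨rfl, rfl⟩
    · exact absurd hxy hV.right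
    · exact absurd hxy (hV.above 0 (by omega))
    · exact absurd hxy (hV.above (0 - 1) (by omega))
    · exact absurd hxy (hV.left _ (by omega))
    · omega
    · omega
  obtain ⟨⟨x, y⟩, h1, h2, h3⟩ := hV.two_le_degree _ h0 (0, 0)
  obtain ⟨⟨z, w⟩, h4, h5, h6⟩ := hV.two_le_degree _ h0 (1, 0)
  have h7 := h x y h1 h2
  have h8 := h z w h4 h5
  simp only [ne_eq, Prod.mk.injEq] at h3 h6
  exact hV.triangleFree.false h0 h1 h4 (by simp only [triangularLattice_adj]; omega)

theorem middle (hV : PeakRun V k) {x y : ℤ} (hy : y = 0) (h : 1 ≤ x) (h' : x < k) :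
    (x, y) ∉ V := fun hxy =>
  hV.triangleFree.false (hV.mem (x - 1) (by omega) (by omega)) (hV.mem x (by omega) h') hxy
    (by simp only [triangularLattice_adj]; omega)

theorem foot_left (hV : PeakRun V k) : (0, 0) ∈ V := by
  have hk := hV.two_le
  have h0 := hV.mem 0 le_rfl (by omega)
  obtain ⟨⟨x, y⟩, h1, h2, h3⟩ := hV.two_le_degree _ h0 (1, 1)
  simp only [ne_eq, Prod.mk.injEq] at h3
  rcases triangularLattice_adj_cases h2 with ⟨rfl, rfl⟩ | ⟨rfl, rfl⟩ | ⟨rfl, rfl⟩ |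
      ⟨rfl, rfl⟩ | ⟨rfl, rfl⟩ | ⟨rfl, rfl⟩
  · omega
  · exact absurd h1 (hV.above 0 (by omega))
  · exact absurd h1 (hV.above (0 - 1) (by omega))
  · exact absurd h1 (hV.left _ (by omega))
  · exact h1
  · exact absurd h1 (hV.middle (by omega) (by omega) (by omega))

theorem foot_right (hV : PeakRun V k) : (k, 0) ∈ V := by
  have hk := hV.two_le
  have h0 := hV.mem (k - 1) (by omega) (by omega)
  obtain ⟨⟨x, y⟩, h1, h2, h3⟩ := hV.two_le_degree _ h0 (k - 2, 1)
  simp only [ne_eq, Prod.mk.injEq] at h3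
  rcases triangularLattice_adj_cases h2 with ⟨rfl, rfl⟩ | ⟨rfl, rfl⟩ | ⟨rfl, rfl⟩ |
      ⟨rfl, rfl⟩ | ⟨rfl, rfl⟩ | ⟨rfl, rfl⟩
  · exact absurd (mem_of_eq h1 (by omega) rfl) hV.right
  · exact absurd h1 (hV.above _ (by omega))
  · exact absurd h1 (hV.above _ (by omega))
  · omega
  · exact absurd h1 (hV.middle (by omega) (by omega) (by omega))
  · exact mem_of_eq h1 (by omega) (by omega)

theorem neighbors_foot_left (hV : PeakRun V k) : ∀ u ∈ withoutRun V k,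
    triangularLattice.Adj (0, 0) u → u = (-1, 0) ∨ u = (0, -1) ∨ u = (1, -1) := by
  have hk := hV.two_le
  rintro ⟨x, y⟩ hu hadj
  simp only [Prod.mk.injEq]
  rcases triangularLattice_adj_cases hadj with ⟨rfl, rfl⟩ | ⟨rfl, rfl⟩ | ⟨rfl, rfl⟩ |
      ⟨rfl, rfl⟩ | ⟨rfl, rfl⟩ | ⟨rfl, rfl⟩
  · exact absurd hu.1 (hV.middle (by omega) (by omega) (by omega))
  · exact absurd (by simp only; omega) hu.2
  · exact absurd hu.1 (hV.left _ (by omega))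
  all_goals omega

theorem exists_neighbor_foot_right (hV : PeakRun V k) : ∃ n₁ : ℤ × ℤ,
    ∀ u ∈ withoutRun V k, triangularLattice.Adj (k, 0) u → u = n₁ ∨ u = (k, -1) := by
  classical
  have hk := hV.two_le
  -- These two candidates are adjacent to each other and to the foot, so at most one is in `V`.
  refine ⟨if (k + 1, 0) ∈ V then (k + 1, 0) else (k + 1, -1), ?_⟩
  rintro ⟨x, y⟩ hu hadj
  rcases triangularLattice_adj_cases hadj with ⟨rfl, rfl⟩ | ⟨rfl, rfl⟩ | ⟨rfl, rfl⟩ |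
      ⟨rfl, rfl⟩ | ⟨rfl, rfl⟩ | ⟨rfl, rfl⟩
  · simp [withoutRun_subset hu]
  · exact absurd hu.1 hV.right
  · exact absurd (by simp only [zero_add, true_and]; omega) hu.2
  · exact absurd hu.1 (hV.middle (by omega) (by omega) (by omega))
  · simp
  · left
    rw [if_neg]
    · simp
    · intro h
      exact hV.triangleFree.false hV.foot_right h hu.1
        (by simp only [triangularLattice_adj]; omega)

/-- The hypothesis `hx` makes (k, -1), if present, a vertex of degree two, so it can play the role
of `n₂`. -/
theorem exists_flexible_foot_right (hV : PeakRun V k)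
    (hc : KneserColoring triangularLattice (withoutRun V k) c)
    (hx : (k, -1) ∈ V → (k - 1, -1) ∉ V) :
    ∃ X Y T, ¬ Triple.Close Y T ∧ Flexible triangularLattice (withoutRun V k) c (k, 0) X Y T := by
  have hk := hV.two_le
  obtain ⟨n₁, hn⟩ := hV.exists_neighbor_foot_right
  have hb : ∃ w', (w' = (k, -2) ∨ w' = (k + 1, -2)) ∧ ((k, -1) ∈ V →
      w' ∈ V ∧ triangularLattice.Adj (k, -1) w' ∧
        ∀ u ∈ V, triangularLattice.Adj (k, -1) u → u = (k, 0) ∨ u = w') := by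
    by_cases hxV : (k, -1) ∈ V
    · have H := exists_unique_other_neighbor hV.triangleFree hV.two_le_degree
        (v := (k, 0)) (w₁ := (k, -2)) (w₂ := (k + 1, -2)) hxV
        (by simp only [triangularLattice_adj]; omega) ?_
      · obtain ⟨w', h, h'⟩ := H
        exact ⟨w', h, fun _ => h'⟩
      · rintro ⟨x, y⟩ hu hadj
        simp only [Prod.mk.injEq]
        rcases triangularLattice_adj_cases hadj with ⟨rfl, rfl⟩ | ⟨rfl, rfl⟩ | ⟨rfl, rfl⟩ |
            ⟨rfl, rfl⟩ | ⟨rfl, rfl⟩ | ⟨rfl, rfl⟩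
        · exact (hV.triangleFree.false hV.foot_right hxV hu
            (by simp only [triangularLattice_adj]; omega)).elim
        · omega
        · exact absurd hu (hV.middle (by omega) (by omega) (by omega))
        · exact absurd hu (hx hxV)
        · omega
        · omega
    · exact ⟨_, .inl rfl, fun h => absurd h hxV⟩
  obtain ⟨w', hw', hb⟩ := hb
  have H := exists_flexible hV.triangleFree_withoutRun (v := (k, 0))
    (mem_withoutRun hV.foot_right (by omega)) hc n₁ (k, -1) w' hn ?_
  · obtain ⟨Y, T, h, hf⟩ := H
    exact ⟨_, Y, T, h, hf⟩
  · intro h h'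
    obtain ⟨h2, h3, h4⟩ := hb h.1
    refine ⟨⟨h2, ?_⟩, h3, fun u hu => h4 u hu.1⟩
    rcases hw' with rfl | rfl <;> simp

theorem exists_neighbor_left (hV : PeakRun V k) (h : (-1, 0) ∈ V) :
    ∃ t, (t = (-2, 0) ∨ t = (-1, -1)) ∧ t ∈ withoutRun V k ∧ triangularLattice.Adj (-1, 0) t ∧
      ∀ u ∈ withoutRun V k, triangularLattice.Adj (-1, 0) u → u = (0, 0) ∨ u = t := by
  have hk := hV.two_le
  have H := exists_unique_other_neighbor hV.triangleFree hV.two_le_degree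
    (v := (0, 0)) (w₁ := (-2, 0)) (w₂ := (-1, -1)) h
    (by simp only [triangularLattice_adj]; omega) ?_
  · obtain ⟨w', h1, h2, h3, h4⟩ := H
    refine ⟨w', h1, ⟨h2, ?_⟩, h3, fun u hu => h4 u hu.1⟩
    rcases h1 with rfl | rfl <;> simp
  · rintro ⟨x, y⟩ hu hadj
    simp only [Prod.mk.injEq]
    rcases triangularLattice_adj_cases hadj with ⟨rfl, rfl⟩ | ⟨rfl, rfl⟩ | ⟨rfl, rfl⟩ |
        ⟨rfl, rfl⟩ | ⟨rfl, rfl⟩ | ⟨rfl, rfl⟩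
    · omega
    · exact absurd hu (hV.left _ (by omega))
    · exact absurd hu (hV.left _ (by omega))
    · omega
    · omega
    · exact (hV.triangleFree.false hV.foot_left h hu
        (by simp only [triangularLattice_adj]; omega)).elim

theorem exists_neighbor_below (hV : PeakRun V k) (h : (1, -1) ∈ V) (h' : (2, -1) ∉ V) :
    ∃ t, (t = (1, -2) ∨ t = (2, -2)) ∧ t ∈ withoutRun V k ∧ triangularLattice.Adj (1, -1) t ∧
      ∀ u ∈ withoutRun V k, triangularLattice.Adj (1, -1) u → u = (0, 0) ∨ u = t := by
  have hk := hV.two_le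
  have H := exists_unique_other_neighbor hV.triangleFree hV.two_le_degree
    (v := (0, 0)) (w₁ := (1, -2)) (w₂ := (2, -2)) h
    (by simp only [triangularLattice_adj]; omega) ?_
  · obtain ⟨w', h1, h2, h3, h4⟩ := H
    refine ⟨w', h1, ⟨h2, ?_⟩, h3, fun u hu => h4 u hu.1⟩
    rcases h1 with rfl | rfl <;> simp
  · rintro ⟨x, y⟩ hu hadj
    simp only [Prod.mk.injEq]
    rcases triangularLattice_adj_cases hadj with ⟨rfl, rfl⟩ | ⟨rfl, rfl⟩ | ⟨rfl, rfl⟩ |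
        ⟨rfl, rfl⟩ | ⟨rfl, rfl⟩ | ⟨rfl, rfl⟩
    · exact absurd hu h'
    · exact absurd hu (hV.middle (by omega) (by omega) (by omega))
    · omega
    · exact (hV.triangleFree.false hV.foot_left h hu
        (by simp only [triangularLattice_adj]; omega)).elim
    · omega
    · omega

/-- Here (-1, 0) plays the role of `n₂`. The bound on `X` keeps it away from the right foot and its
neighbors, so the right foot may be recolored beforehand. -/
theorem exists_flexible_foot_left (hV : PeakRun V k)
    (hc : KneserColoring triangularLattice (withoutRun V k) c) :
    ∃ X Y T, ¬ Triple.Close Y T ∧ Flexible triangularLattice (withoutRun V k) c (0, 0) X Y T ∧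
      ∀ u ∈ X, u.1 + u.2 ≤ 0 := by
  classical
  have hk := hV.two_le
  have hb : ∃ w', (w' = (-2, 0) ∨ w' = (-1, -1)) ∧ ((-1, 0) ∈ V →
      w' ∈ withoutRun V k ∧ triangularLattice.Adj (-1, 0) w' ∧
        ∀ u ∈ withoutRun V k, triangularLattice.Adj (-1, 0) u → u = (0, 0) ∨ u = w') := by
    by_cases h : (-1, 0) ∈ V
    · obtain ⟨t, h1, h2⟩ := hV.exists_neighbor_left h
      exact ⟨t, h1, fun _ => h2⟩
    · exact ⟨_, .inl rfl, fun h' => absurd h' h⟩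
  obtain ⟨w', hw', hb⟩ := hb
  have H := exists_flexible hV.triangleFree_withoutRun (v := (0, 0))
    (mem_withoutRun hV.foot_left (by omega)) hc
    (if (1, -1) ∈ V then (1, -1) else (0, -1)) (-1, 0) w' ?_ (fun h _ => hb h.1)
  · obtain ⟨Y, T, h, hf⟩ := H
    refine ⟨_, Y, T, h, hf, ?_⟩
    rintro u (rfl | rfl)
    · split_ifs <;> simp
    · rcases hw' with rfl | rfl <;> simp
  · intro u hu hadj
    rcases hV.neighbors_foot_left u hu hadj with rfl | rfl | rfl
    · simp
    · left
      rw [if_neg]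
      intro h
      exact hV.triangleFree.false hV.foot_left h hu.1
        (by simp only [triangularLattice_adj]; omega)
    · simp [withoutRun_subset hu]

/-- If the left foot is flat, then the vertex below it has two possible colors as soon as the
color of the left foot is erased. -/
theorem exists_flexible_below (hV : PeakRun V k)
    (hc : KneserColoring triangularLattice (withoutRun V k) c)
    (h1 : (1, -1) ∉ V) (h2 : (-1, 0) ∉ V) :
    (0, -1) ∈ withoutRun V k ∧
    (∀ u ∈ withoutRun V k, triangularLattice.Adj (0, 0) u → u = (0, -1)) ∧
    ∃ X Y T, ¬ Triple.Close Y T ∧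
      Flexible triangularLattice (withoutRun V k \ {(0, 0)}) c (0, -1) X Y T ∧
      ∀ u ∈ X, u.1 + u.2 ≤ 0 := by
  classical
  have hk := hV.two_le
  have hq : ∀ u ∈ withoutRun V k, triangularLattice.Adj (0, 0) u → u = (0, -1) := by
    intro u hu hadj
    rcases hV.neighbors_foot_left u hu hadj with rfl | rfl | rfl
    · exact absurd hu.1 h2
    · rfl
    · exact absurd hu.1 h1
  have hz : (0, -1) ∈ V := by
    obtain ⟨u, hu, hadj, hne⟩ := hV.two_le_degree _ hV.foot_left (0, 1)
    by_cases hu' : u ∈ withoutRun V k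
    · exact hq u hu' hadj ▸ hu
    · obtain ⟨x, y⟩ := u
      simp only [withoutRun, Set.mem_ofPred_eq, hu, true_and, not_not] at hu'
      rw [triangularLattice_adj] at hadj
      simp only [ne_eq, Prod.mk.injEq] at hne
      omega
  have hz' : (0, -1) ∈ withoutRun V k := mem_withoutRun hz (by omega)
  refine ⟨hz', hq, ?_⟩
  have hb : ∃ w', (w' = (-2, -1) ∨ w' = (-1, -2)) ∧ ((-1, -1) ∈ V →
      w' ∈ V ∧ triangularLattice.Adj (-1, -1) w' ∧
        ∀ u ∈ V, triangularLattice.Adj (-1, -1) u → u = (0, -1) ∨ u = w') := by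
    by_cases hs : (-1, -1) ∈ V
    · have H := exists_unique_other_neighbor hV.triangleFree hV.two_le_degree
        (v := (0, -1)) (w₁ := (-2, -1)) (w₂ := (-1, -2)) hs
        (by simp only [triangularLattice_adj]; omega) ?_
      · obtain ⟨w', h, h'⟩ := H
        exact ⟨w', h, fun _ => h'⟩
      · rintro ⟨x, y⟩ hu hadj
        simp only [Prod.mk.injEq]
        rcases triangularLattice_adj_cases hadj with ⟨rfl, rfl⟩ | ⟨rfl, rfl⟩ | ⟨rfl, rfl⟩ |
            ⟨rfl, rfl⟩ | ⟨rfl, rfl⟩ | ⟨rfl, rfl⟩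
        · omega
        · exact absurd hu h2
        · exact absurd (hV.below hu) h2
        · omega
        · omega
        · exact (hV.triangleFree.false hz hs hu
            (by simp only [triangularLattice_adj]; omega)).elim
    · exact ⟨_, .inl rfl, fun h => absurd h hs⟩
  obtain ⟨w', hw', hb⟩ := hb
  have H := exists_flexible
    (hV.triangleFree_withoutRun.mono (S' := withoutRun V k \ {(0, 0)}) Set.sdiff_subset)
    (v := (0, -1)) ⟨hz', by simp⟩ (hc.mono Set.sdiff_subset)
    (if (0, -2) ∈ V then (0, -2) else (1, -2)) (-1, -1) w' ?_ ?_
  · obtain ⟨Y, T, h, hf⟩ := H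
    refine ⟨_, Y, T, h, hf, ?_⟩
    rintro u (rfl | rfl)
    · split_ifs <;> simp
    · rcases hw' with rfl | rfl <;> simp
  · rintro ⟨x, y⟩ hu hadj
    rcases triangularLattice_adj_cases hadj with ⟨rfl, rfl⟩ | ⟨rfl, rfl⟩ | ⟨rfl, rfl⟩ |
        ⟨rfl, rfl⟩ | ⟨rfl, rfl⟩ | ⟨rfl, rfl⟩
    · exact absurd hu.1.1 h1
    · exact absurd rfl hu.2
    · exact absurd hu.1.1 h2
    · simp
    · left
      rw [if_pos (mem_of_eq hu.1.1 (by omega) (by omega))]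
      simp
    · left
      rw [if_neg]
      · simp
      · intro h
        exact hV.triangleFree.false hz h hu.1.1
          (by simp only [triangularLattice_adj]; omega)
  · intro h h'
    obtain ⟨h3, h4, h5⟩ := hb h.1.1
    refine ⟨⟨⟨h3, ?_⟩, ?_⟩, h4, fun u hu => h5 u hu.1.1⟩ <;>
    rcases hw' with rfl | rfl <;> simp

end PeakRun

/-! ### Restoring a peak run. -/

namespace PeakRun

variable {V : Set (ℤ × ℤ)} {k : ℤ} {c : ℤ × ℤ → Triple}

theorem not_adj_foot_right (hk : 2 ≤ k) {u : ℤ × ℤ} (hu : u.1 + u.2 ≤ 0) :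
    u ≠ (k, 0) ∧ ¬ triangularLattice.Adj (k, 0) u := by
  obtain ⟨x, y⟩ := u
  simp only [triangularLattice_adj, ne_eq, Prod.mk.injEq] at *
  omega

/-- A run of two vertices can be restored after recoloring near its feet. -/
theorem exists_walk_of_two (hV : PeakRun V 2)
    (hc : KneserColoring triangularLattice (withoutRun V 2) c) :
    ∃ c', KneserColoring triangularLattice (withoutRun V 2) c' ∧
      Triple.Walk 3 (c' (0, 0)) (c' (2, 0)) := by
  have hq : (0, 0) ∈ withoutRun V 2 := mem_withoutRun hV.foot_left (by omega)
  have hr : (2, 0) ∈ withoutRun V 2 := mem_withoutRun hV.foot_right (by omega)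
  have hS := hV.triangleFree_withoutRun
  by_cases hy : (1, -1) ∈ V
  · have hyS : (1, -1) ∈ withoutRun V 2 := mem_withoutRun hy (by omega)
    by_cases hx : (2, -1) ∈ V
    · have hxS : (2, -1) ∈ withoutRun V 2 := mem_withoutRun hx (by omega)
      -- The path under the run has length 3, so its colors already form the walk.
      exact ⟨c, hc, .cons (hc _ hq _ hyS (by simp only [triangularLattice_adj]; omega))
        (.cons (hc _ hyS _ hxS (by simp only [triangularLattice_adj]; omega))
        (.cons (hc _ hxS _ hr (by simp only [triangularLattice_adj]; omega)) (.nil _)))⟩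
    · obtain ⟨y', hy', hy'S, hyy', hyn⟩ := hV.exists_neighbor_below hy hx
      obtain ⟨t, ht, htn⟩ : ∃ t, ((-1, 0) ∈ V → t ∈ withoutRun V 2 ∧
          ∀ u ∈ withoutRun V 2, triangularLattice.Adj (-1, 0) u → u = (0, 0) ∨ u = t) ∧
          (c (0, 0)).Close (c t) ∧ t ≠ (2, 0) ∧ ¬ triangularLattice.Adj (2, 0) t := by
        by_cases hl : (-1, 0) ∈ V
        · obtain ⟨t, ht, htS, hadj, htn⟩ := hV.exists_neighbor_left hl
          refine ⟨t, fun _ => ⟨htS, htn⟩, ?_, not_adj_foot_right le_rfl ?_⟩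
          · have hlS : (-1, 0) ∈ withoutRun V 2 := mem_withoutRun hl (by omega)
            exact (hc _ hq _ hlS (by simp only [triangularLattice_adj]; omega)).close
              (hc _ hlS _ htS hadj)
          · rcases ht with rfl | rfl <;> simp
        · exact ⟨(0, 0), fun h => absurd h hl, Triple.close_self _,
            not_adj_foot_right le_rfl (by simp)⟩
      obtain ⟨n₁, hn⟩ := hV.exists_neighbor_foot_right
      have hqy := hc _ hq _ hyS (by simp only [triangularLattice_adj]; omega)
      -- The left foot needs a color close to those of `y'` and `t`; these meet, being both close to
      -- its present color. The right foot is constrained by `n₁` alone.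
      obtain ⟨A, hA1, hA2, hA3⟩ := Triple.exists_close_close_not_disj
        ((hqy.close (hc _ hyS _ hy'S hyy')).not_disj htn.1) (c n₁)
      obtain ⟨B, hB1, hB2⟩ := Triple.exists_disj_not_close hA3
      obtain ⟨c₁, hc₁, hB, hcc₁⟩ := exists_recoloring (A := B) hS hr (hc.mono Set.sdiff_subset) (by
        intro w hw hadj
        rcases hn w hw hadj with rfl | rfl
        · exact .inl hB1
        · exact absurd hw.1 hx)
      obtain ⟨c₂, hc₂, hA, hcc₂⟩ := exists_recoloring (A := A) hS hq
        (hc₁.mono Set.sdiff_subset) (by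
        intro w hw hadj
        right
        rcases hV.neighbors_foot_left w hw hadj with rfl | rfl | rfl
        · obtain ⟨htS, htn'⟩ := ht hw.1
          refine ⟨t, htS, htn', ?_⟩
          rwa [hcc₁ t htn.2.1 htn.2.2]
        · exact (hV.triangleFree.false hV.foot_left hy hw.1
            (by simp only [triangularLattice_adj]; omega)).elim
        · refine ⟨y', hy'S, hyn, ?_⟩
          rw [hcc₁ y']
          · exact hA1
          · rcases hy' with rfl | rfl <;> simp
          · rcases hy' with rfl | rfl <;> (simp only [triangularLattice_adj]; omega))
      refine ⟨c₂, hc₂, Triple.walk_three ?_⟩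
      rw [hA, hcc₂ _ (by simp) (by simp only [triangularLattice_adj]; omega), hB]
      exact fun h => hB2 h.symm
  · obtain ⟨X, Y, T, hYT, hf⟩ := hV.exists_flexible_foot_right hc (fun _ h => hy h)
    by_cases hl : (-1, 0) ∈ V
    · obtain ⟨t, ht, htS, -, htn⟩ := hV.exists_neighbor_left hl
      -- The left foot is constrained only by closeness to the color of `t`, which suffices unless
      -- the right foot has exactly that color.
      obtain ⟨B, hB1, hB2, hB3⟩ := Triple.exists_ne hYT (c t)
      obtain ⟨A, hA1, hA2⟩ := Triple.exists_close_not_close hB3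
      obtain ⟨c₁, hc₁, hB, hcc₁⟩ := hf c (hc.mono Set.sdiff_subset) (fun _ _ => rfl) B hB1 hB2
      obtain ⟨c₂, hc₂, hA, hcc₂⟩ := exists_recoloring (A := A) hS hq
        (hc₁.mono Set.sdiff_subset) (by
        intro w hw hadj
        right
        rcases hV.neighbors_foot_left w hw hadj with rfl | rfl | rfl
        · refine ⟨t, htS, htn, ?_⟩
          have := not_adj_foot_right (u := t) (le_refl 2)
            (by rcases ht with rfl | rfl <;> simp)
          rwa [hcc₁ t this.1 this.2]
        · exact (hV.triangleFree.false hV.foot_left hl hw.1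
            (by simp only [triangularLattice_adj]; omega)).elim
        · exact absurd hw.1 hy)
      refine ⟨c₂, hc₂, Triple.walk_three ?_⟩
      rwa [hA, hcc₂ _ (by simp) (by simp only [triangularLattice_adj]; omega), hB]
    · obtain ⟨hz, hqn, X', Y', T', hYT', hf', hX'⟩ := hV.exists_flexible_below hc hy hl
      -- Only `Z`, the new color of (0, -1), constrains the left foot. `Z` ≠ `Y` allows a color `B`
      -- of the right foot that meets `Z`, and then some `A` disjoint from `Z` is not close to `B`.
      obtain ⟨Z, hZ1, hZ2, hZ3⟩ := Triple.exists_ne hYT' Y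
      obtain ⟨B, hB1, hB2, hB3⟩ := Triple.exists_not_disj_of_ne hYT hZ3
      obtain ⟨A, hA1, hA2⟩ := Triple.exists_disj_not_close hB3
      obtain ⟨c₁, hc₁, hB, hcc₁⟩ := hf c (hc.mono Set.sdiff_subset) (fun _ _ => rfl) B hB1 hB2
      obtain ⟨c₂, hc₂, hZ, hcc₂⟩ := hf' c₁
        (hc₁.mono (Set.sdiff_subset.trans Set.sdiff_subset)) (fun u hu =>
          have := not_adj_foot_right (le_refl 2) (hX' u hu)
          hcc₁ u this.1 this.2) Z hZ1 hZ2
      obtain ⟨c₃, hc₃, hA, hcc₃⟩ := exists_recoloring (A := A) hS hq hc₂ (by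
        intro w hw hadj
        left
        rwa [hqn w hw hadj, hZ])
      refine ⟨c₃, hc₃, Triple.walk_three ?_⟩
      rwa [hA, hcc₃ _ (by simp) (by simp only [triangularLattice_adj]; omega),
        hcc₂ _ (by simp) (by simp only [triangularLattice_adj]; omega), hB]

/-- A run of three vertices can be restored after recoloring near its feet. -/
theorem exists_walk_of_three (hV : PeakRun V 3)
    (hc : KneserColoring triangularLattice (withoutRun V 3) c) :
    ∃ c', KneserColoring triangularLattice (withoutRun V 3) c' ∧
      Triple.Walk 4 (c' (0, 0)) (c' (3, 0)) := by
  have hq : (0, 0) ∈ withoutRun V 3 := mem_withoutRun hV.foot_left (by omega)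
  have hr : (3, 0) ∈ withoutRun V 3 := mem_withoutRun hV.foot_right (by omega)
  have hS := hV.triangleFree_withoutRun
  by_cases hx : (3, -1) ∈ V ∧ (2, -1) ∈ V
  · have hxS : (3, -1) ∈ withoutRun V 3 := mem_withoutRun hx.1 (by omega)
    have hmS : (2, -1) ∈ withoutRun V 3 := mem_withoutRun hx.2 (by omega)
    by_cases hy : (1, -1) ∈ V
    · have hyS : (1, -1) ∈ withoutRun V 3 := mem_withoutRun hy (by omega)
      exact ⟨c, hc, .cons (hc _ hq _ hyS (by simp only [triangularLattice_adj]; omega))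
        (.cons (hc _ hyS _ hmS (by simp only [triangularLattice_adj]; omega))
        (.cons (hc _ hmS _ hxS (by simp only [triangularLattice_adj]; omega))
        (.cons (hc _ hxS _ hr (by simp only [triangularLattice_adj]; omega)) (.nil _))))⟩
    · by_cases hl : (-1, 0) ∈ V
      · obtain ⟨t, ht, htS, -, htn⟩ := hV.exists_neighbor_left hl
        obtain ⟨A, hA1, hA2⟩ := Triple.exists_close_not_disj (c t) (c (3, 0))
        obtain ⟨c₂, hc₂, hA, hcc₂⟩ := exists_recoloring (A := A) hS hq
          (hc.mono Set.sdiff_subset) (by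
          intro w hw hadj
          right
          rcases hV.neighbors_foot_left w hw hadj with rfl | rfl | rfl
          · exact ⟨t, htS, htn, hA1⟩
          · exact (hV.triangleFree.false hV.foot_left hl hw.1
              (by simp only [triangularLattice_adj]; omega)).elim
          · exact absurd hw.1 hy)
        refine ⟨c₂, hc₂, Triple.walk_four ?_⟩
        rwa [hA, hcc₂ _ (by simp) (by simp only [triangularLattice_adj]; omega)]
      · obtain ⟨hz, hqn, X', Y', T', hYT', hf', -⟩ := hV.exists_flexible_below hc hy hl
        obtain ⟨Z, hZ1, hZ2, hZ3⟩ := Triple.exists_ne hYT' (c (3, 0))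
        obtain ⟨A, hA1, hA2⟩ := Triple.exists_disj_not_disj hZ3
        obtain ⟨c₂, hc₂, hZ, hcc₂⟩ := hf' c
          (hc.mono (Set.sdiff_subset.trans Set.sdiff_subset)) (fun _ _ => rfl) Z hZ1 hZ2
        obtain ⟨c₃, hc₃, hA, hcc₃⟩ := exists_recoloring (A := A) hS hq hc₂ (by
          intro w hw hadj
          left
          rwa [hqn w hw hadj, hZ])
        refine ⟨c₃, hc₃, Triple.walk_four ?_⟩
        rwa [hA, hcc₃ _ (by simp) (by simp only [triangularLattice_adj]; omega),
          hcc₂ _ (by simp) (by simp only [triangularLattice_adj]; omega)]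
  -- Now both feet are flexible, and they can be given colors that meet.
  · obtain ⟨X, Y, T, hYT, hf⟩ :=
      hV.exists_flexible_foot_right hc (fun h h' => hx ⟨h, h'⟩)
    obtain ⟨X', Y', T', hYT', hf', hX'⟩ := hV.exists_flexible_foot_left hc
    obtain ⟨A, B, hA1, hA2, hB1, hB2, hAB⟩ := Triple.exists_not_disj hYT' hYT
    obtain ⟨c₁, hc₁, hB, hcc₁⟩ := hf c (hc.mono Set.sdiff_subset) (fun _ _ => rfl) B hB1 hB2
    obtain ⟨c₂, hc₂, hA, hcc₂⟩ := hf' c₁ (hc₁.mono Set.sdiff_subset) (fun u hu =>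
      have := not_adj_foot_right (by norm_num) (hX' u hu)
      hcc₁ u this.1 this.2) A hA1 hA2
    refine ⟨c₂, hc₂, Triple.walk_four ?_⟩
    rwa [hA, hcc₂ _ (by simp) (by simp only [triangularLattice_adj]; omega), hB]

/-- A run of four vertices can be restored after recoloring near its feet. -/
theorem exists_walk_of_four (hV : PeakRun V 4)
    (hc : KneserColoring triangularLattice (withoutRun V 4) c) :
    ∃ c', KneserColoring triangularLattice (withoutRun V 4) c' ∧
      Triple.Walk 5 (c' (0, 0)) (c' (4, 0)) := by
  obtain ⟨X', Y', T', hYT', hf', -⟩ := hV.exists_flexible_foot_left hc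
  obtain ⟨A, hA1, hA2, hA3⟩ := Triple.exists_ne hYT' (c (4, 0))
  obtain ⟨c₂, hc₂, hA, hcc₂⟩ := hf' c (hc.mono Set.sdiff_subset) (fun _ _ => rfl) A hA1 hA2
  refine ⟨c₂, hc₂, Triple.walk_five ?_⟩
  rwa [hA, hcc₂ _ (by simp) (by simp only [triangularLattice_adj]; omega)]

theorem exists_walk {n : ℕ} (hV : PeakRun V n)
    (hc : KneserColoring triangularLattice (withoutRun V n) c) :
    ∃ c', KneserColoring triangularLattice (withoutRun V n) c' ∧
      Triple.Walk (n + 1) (c' (0, 0)) (c' (n, 0)) := by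
  have hk := hV.two_le
  rcases (by omega : n = 2 ∨ n = 3 ∨ n = 4 ∨ 5 ≤ n) with rfl | rfl | rfl | hn
  · exact hV.exists_walk_of_two hc
  · exact hV.exists_walk_of_three hc
  · exact hV.exists_walk_of_four hc
  · exact ⟨c, hc, Triple.walk_of_six_le (by omega) _ _⟩

theorem exists_extension {n : ℕ} (hV : PeakRun V n)
    (hc : KneserColoring triangularLattice (withoutRun V n) c)
    (hw : Triple.Walk (n + 1) (c (0, 0)) (c (n, 0))) :
    ∃ c', KneserColoring triangularLattice V c' := by
  classical
  have hk := hV.two_le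
  obtain ⟨g, hg0, hgn, hg⟩ := hw
  -- Positions 0 and n + 1 of the walk belong to the feet, hence the shift by one.
  refine ⟨fun v => if v.2 = 1 ∧ 0 ≤ v.1 ∧ v.1 < n then g (v.1 + 1).toNat else c v, ?_⟩
  have key : ∀ x : ℤ, 0 ≤ x → x < n → ∀ y w, (y, w) ∈ V → triangularLattice.Adj (x, 1) (y, w) →
      (g (x + 1).toNat).Disj
        (if w = 1 ∧ 0 ≤ y ∧ y < n then g (y + 1).toNat else c (y, w)) := by
    intro x hx0 hxn y w hyw hadj
    have hx : (x, 1) ∈ V := hV.mem x hx0 hxn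
    rcases triangularLattice_adj_cases hadj with ⟨rfl, rfl⟩ | ⟨rfl, rfl⟩ | ⟨rfl, rfl⟩ |
      ⟨rfl, rfl⟩ | ⟨rfl, rfl⟩ | ⟨rfl, rfl⟩
    · by_cases h : x + 1 < n
      · rw [if_pos (by omega), show (x + 1 + 1).toNat = (x + 1).toNat + 1 by omega]
        exact hg _ (by omega)
      · exact absurd (mem_of_eq hyw (by omega) rfl) hV.right
    · exact absurd hyw (hV.above _ (by omega))
    · exact absurd hyw (hV.above _ (by omega))
    · by_cases h : 0 ≤ x - 1
      · rw [if_pos (by omega), show (x + 1).toNat = (x - 1 + 1).toNat + 1 by omega]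
        exact (hg _ (by omega)).symm
      · exact absurd hyw (hV.left _ (by omega))
    · by_cases h : 1 ≤ y
      · exact absurd hyw (hV.middle (by omega) h hxn)
      · obtain rfl : y = 0 := by omega
        rw [if_neg (by omega)]
        have := hg 0 (by omega)
        rw [hg0] at this
        exact this.symm
    · by_cases h : x + 1 < n
      · exact absurd hyw (hV.middle (by omega) (by omega) h)
      · obtain rfl : x = n - 1 := by omega
        have := hg n (by omega)
        rw [hgn] at this
        rw [if_neg (by omega)]
        simpa using this
  rintro ⟨x, y⟩ hv ⟨z, w⟩ hw hadj
  by_cases h1 : y = 1 ∧ 0 ≤ x ∧ x < n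
  · obtain ⟨rfl, h0, h1⟩ := h1
    have := key x h0 h1 z w hw hadj
    simpa [h0, h1] using this
  · by_cases h2 : w = 1 ∧ 0 ≤ z ∧ z < n
    · obtain ⟨rfl, h0, h2⟩ := h2
      have := (key z h0 h2 x y hv hadj.symm).symm
      simpa [h0, h2] using this
    · simp only [h1, h2, if_false]
      exact hc _ ⟨hv, h1⟩ _ ⟨hw, h2⟩ hadj

end PeakRun

/-! ### Existence of a peak run, and the induction. -/

theorem triangularLattice_adj_add {u v τ : ℤ × ℤ} :
    triangularLattice.Adj (u + τ) (v + τ) ↔ triangularLattice.Adj u v := by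
  simp [triangularLattice]

/-- A nonempty finite set without triangles and without vertices of degree less than two has a
peak run after a translation. -/
theorem exists_peakRun {V : Set (ℤ × ℤ)} (hfin : V.Finite) (hne : V.Nonempty)
    (htf : TriangleFreeOn triangularLattice V)
    (hdeg : ∀ v ∈ V, ∀ w₀, ∃ w ∈ V, triangularLattice.Adj v w ∧ w ≠ w₀) :
    ∃ (τ : ℤ × ℤ) (n : ℕ), PeakRun {v | v + τ ∈ V} n := by
  -- the vertex `p` is the right end of a run, and the row above has no vertex up to that point
  let P : ℤ × ℤ → Prop := fun p => p ∈ V ∧ (p.1 + 1, p.2) ∉ V ∧ ∀ i ≤ p.1, (i, p.2 + 1) ∉ V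
  have hP : {p | P p}.Nonempty := by
    -- The rightmost vertex of the top row has the property `P`.
    obtain ⟨⟨x, y⟩, hxy, hmax⟩ := hfin.exists_maximalFor (fun p => toLex (p.2, p.1)) V hne
    refine ⟨(x, y), hxy, fun h => ?_, fun i _ h => ?_⟩
    · have := hmax h (Prod.Lex.toLex_le_toLex.2 (.inr ⟨rfl, by simp⟩))
      simp [Prod.Lex.toLex_le_toLex] at this
    · have := hmax h (Prod.Lex.toLex_le_toLex.2 (.inl (by simp)))
      simp [Prod.Lex.toLex_le_toLex] at this
  -- The lowest such row is taken; this minimality yields the field `below`.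
  obtain ⟨⟨e, b⟩, ⟨he, he', hab⟩, hmin⟩ :=
    (hfin.subset fun p (hp : P p) => hp.1).exists_minimalFor (fun p => p.2) {p | P p} hP
  obtain ⟨⟨a, b'⟩, ⟨ha, rfl⟩, hamin⟩ :=
    (hfin.subset fun p (hp : p ∈ V ∧ p.2 = b) => hp.1).exists_minimalFor (fun p => p.1)
      {p | p ∈ V ∧ p.2 = b} ⟨_, he, rfl⟩
  simp only at he he' hab hmin hamin
  have hleft : ∀ i < a, (i, b') ∉ V := fun i hi h => by
    have := hamin (j := (i, b')) ⟨h, rfl⟩ hi.le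
    simp only at this
    omega
  have hae : a ≤ e := by
    by_contra h
    exact hleft e (by omega) he
  -- The run starts at the leftmost vertex of the row and stops at the first gap, which comes no
  -- later than e + 1; so the run may end before `e`.
  have hex : ∃ n : ℕ, (a + n, b') ∉ V :=
    ⟨(e + 1 - a).toNat, by rwa [show a + ((e + 1 - a).toNat : ℤ) = e + 1 by omega]⟩
  classical
  have hn := Nat.find_spec hex
  have hn' := fun m => Nat.find_min hex (m := m)
  have hne : Nat.find hex ≤ (e + 1 - a).toNat :=
    Nat.find_min' hex (by rwa [show a + ((e + 1 - a).toNat : ℤ) = e + 1 by omega])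
  generalize Nat.find hex = n at hn hn' hne
  refine ⟨(a, b' - 1), n, ⟨?_, ?_, ?_, ?_, ?_, ?_, ?_, ?_⟩⟩
  · intro u hu v hv w hw huv hvw huw
    exact htf _ hu _ hv _ hw (triangularLattice_adj_add.2 huv) (triangularLattice_adj_add.2 hvw)
      (triangularLattice_adj_add.2 huw)
  · intro v hv w₀
    obtain ⟨w, hw, hadj, hne⟩ := hdeg _ hv (w₀ + (a, b' - 1))
    refine ⟨w - (a, b' - 1), by simpa using hw, ?_, fun h => hne (by simp [← h])⟩
    rw [← triangularLattice_adj_add (τ := (a, b' - 1))]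
    simpa using hadj
  · rcases Nat.eq_zero_or_pos n with rfl | h
    · simp [ha] at hn
    · exact_mod_cast h
  · intro i h0 hi
    have := hn' i.toNat (by omega)
    rw [not_not, Int.toNat_of_nonneg h0] at this
    change (i + a, 1 + (b' - 1)) ∈ V
    rwa [add_comm i, show 1 + (b' - 1) = b' by ring]
  · intro i hi h
    change (i + a, 1 + (b' - 1)) ∈ V at h
    rw [show 1 + (b' - 1) = b' by ring] at h
    exact hleft _ (by omega) h
  · change ¬ (n + a, 1 + (b' - 1)) ∈ V
    rwa [add_comm (n : ℤ), show 1 + (b' - 1) = b' by ring]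
  · intro i hi h
    change (i + a, 2 + (b' - 1)) ∈ V at h
    rw [show 2 + (b' - 1) = b' + 1 by ring] at h
    exact hab _ (by omega) h
  · intro h
    by_contra h'
    change (-2 + a, 0 + (b' - 1)) ∈ V at h
    change ¬ (-1 + a, 0 + (b' - 1)) ∈ V at h'
    rw [zero_add] at h h'
    -- If (-1, 0) were missing, (-2, 0) would be the right end of a run one row lower, with nothing
    -- above it or to the left of that, because the row of the peak run begins at 0.
    have := hmin (j := (-2 + a, b' - 1)) ⟨h, ?_, ?_⟩ (by simp)
    · simp at this
    · rwa [show (-2 + a + 1 : ℤ) = -1 + a by ring]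
    · intro i hi
      simp only [sub_add_cancel]
      exact hleft i (by simp only at hi; omega)

theorem exists_kneserColoring (m : ℕ) : ∀ V : Set (ℤ × ℤ), V.Finite → V.ncard = m →
    TriangleFreeOn triangularLattice V → ∃ c, KneserColoring triangularLattice V c := by
  classical
  induction m using Nat.strong_induction_on with
  | _ m ih =>
  intro V hfin hm htf
  subst hm
  have ih : ∀ S ⊆ V, (∃ v ∈ V, v ∉ S) → ∃ c, KneserColoring triangularLattice S c := by
    rintro S hS ⟨v, hv, hvS⟩
    exact ih _ (Set.ncard_lt_ncard ⟨hS, fun h => hvS (h hv)⟩ hfin) S (hfin.subset hS) rfl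
      (htf.mono hS)
  rcases V.eq_empty_or_nonempty with rfl | hne
  · exact ⟨fun _ => ⟨7, by decide⟩, fun v hv => absurd hv (by simp)⟩
  by_cases hdeg : ∀ v ∈ V, ∀ w₀, ∃ w ∈ V, triangularLattice.Adj v w ∧ w ≠ w₀
  · obtain ⟨τ, n, hV⟩ := exists_peakRun hfin hne htf hdeg
    have hk := hV.two_le
    obtain ⟨c, hc⟩ := ih {v | v - τ ∈ withoutRun {v | v + τ ∈ V} n}
      (fun v hv => by simpa using hv.1)
      ⟨(0, 1) + τ, hV.mem 0 le_rfl (by omega), fun h => by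
        have h := h.2
        simp at h
        omega⟩
    have hc' : KneserColoring triangularLattice (withoutRun {v | v + τ ∈ V} n)
        (fun v => c (v + τ)) := fun v hv w hw hadj =>
      hc _ (by simpa using hv) _ (by simpa using hw) (triangularLattice_adj_add.2 hadj)
    obtain ⟨c₁, hc₁, hw⟩ := hV.exists_walk hc'
    obtain ⟨c₂, hc₂⟩ := hV.exists_extension hc₁ hw
    refine ⟨fun v => c₂ (v - τ), fun v hv w hw hadj => hc₂ _ ?_ _ ?_ ?_⟩
    · simpa using hv
    · simpa using hw
    · rw [← triangularLattice_adj_add (τ := τ)]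
      simpa using hadj
  · push Not at hdeg
    obtain ⟨v, hv, w₀, hw₀⟩ := hdeg
    obtain ⟨c, hc⟩ := ih (V \ {v}) Set.sdiff_subset ⟨v, hv, by simp⟩
    obtain ⟨A, hA⟩ := (c w₀).exists_disj
    obtain ⟨c', hc', -⟩ := exists_recoloring (A := A) htf hv hc
      (fun w hw hadj => .inl (hw₀ w hw hadj ▸ hA))
    exact ⟨c', hc'⟩

/-- A hexagonal graph has a homomorphism to the Kneser graph `K(7, 3)`. -/
theorem IsHexagonalGraph.exists_triple {V : Type*} {G : SimpleGraph V} (hG : IsHexagonalGraph G) :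
    ∃ c : V → Triple, ∀ v w, G.Adj v w → (c v).Disj (c w) := by
  classical
  obtain ⟨hfin, hfree, ⟨f⟩⟩ := hG
  obtain ⟨c, hc⟩ := exists_kneserColoring _ (Set.range f) (Set.finite_range f) rfl (by
    rintro _ ⟨u, rfl⟩ _ ⟨v, rfl⟩ _ ⟨w, rfl⟩ huv hvw huw
    rw [f.map_adj_iff] at huv hvw huw
    exact hfree {u, v, w} (SimpleGraph.is3Clique_triple_iff.2 ⟨huv, huw, hvw⟩))
  exact ⟨c ∘ f, fun v w hvw => hc _ ⟨v, rfl⟩ _ ⟨w, rfl⟩ (f.map_adj_iff.2 hvw)⟩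

/-! ### From triples to multicolorings. -/

/-- The elements of `Fin a` in the set with the mask `m`. -/
def maskSet (a m : ℕ) : Finset (Fin a) := Finset.univ.filter fun i => m.testBit i

theorem IsHexagonalGraph.isMulticolorable {V : Type*} {G : SimpleGraph V}
    (hG : IsHexagonalGraph G) {a b : ℕ} (f : ℕ → ℕ)
    (hcard : ∀ m ∈ triples, (maskSet a (f m)).card = b)
    (hdisj : (triples.all fun m => triples.all fun n => !maskDisj m n || maskDisj (f m) (f n))
      = true) : IsMulticolorable G a b := by
  obtain ⟨c, hc⟩ := hG.exists_triple
  refine ⟨fun v => maskSet a (f (c v).1), fun v => hcard _ (c v).2, fun v w hvw => ?_⟩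
  have h := Triple.forall_of_all (Triple.forall_of_all hdisj (c v)) (c w)
  rw [show maskDisj (c v).1 (c w).1 = true from hc v w hvw, Bool.not_true, Bool.false_or,
    maskDisj, Nat.beq_eq] at h
  rw [Finset.disjoint_left]
  intro i hi hj
  have h' := congrArg (fun m => m.testBit i) (show f (c v).1 &&& f (c w).1 = 0 from h)
  simp only [maskSet, Finset.mem_filter, Finset.mem_univ, true_and] at hi hj
  simp [hi, hj] at h'

/-- The homomorphism from the Kneser graph `K(n, k)` to `K(n - 2, k - 1)`, on masks: remove the
largest element, and replace the element `n - 2`, if still present, by the largest element that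
was absent. -/
def kneserReduce (n m : ℕ) : ℕ :=
  let m' := m - 2 ^ m.log2
  if m'.testBit (n - 2) then m' - 2 ^ (n - 2) + 2 ^ (2 ^ n - 1 - m).log2 else m'

theorem mainTheorem6 {V : Type*} (G : SimpleGraph V) (hG : IsHexagonalGraph G) :
    IsMulticolorable G 3 1 ∧ IsMulticolorable G 5 2 ∧ IsMulticolorable G 7 3 :=
  -- `kneserReduce` preserves disjointness: if a set A receives its largest absent element j, then A
  -- contains everything above j, so a set disjoint from A has maximum at most j and loses j if it
  -- contained it.
  ⟨hG.isMulticolorable (fun m => kneserReduce 5 (kneserReduce 7 m)) (by decide +kernel)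
      (by decide +kernel),
    hG.isMulticolorable (kneserReduce 7) (by decide +kernel) (by decide +kernel),
    hG.isMulticolorable id (by decide +kernel) (by decide +kernel)⟩
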